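/- **Lemma (strategies as $n\to\infty$).** *Setting.* Let $\mathbf d\in\mathbb R_{\ge 0}^K$ be weakly decreasing, $\mathbf d_1\ge\dots\ge\mathbf d_K$, and not identically $0$. Let $\Delta$ be the set of probability vectors $p\in\mathbb R^K$ with $p_1\ge\dots\ge p_K\ge 0$, and let $X(n,q)$ denote a binomial random variable with parameters $n$ and $q$. A score function is a map $s:\mathbb N\to[0,\infty]$, with $1/\infty=0$. For $\gamma\in(0,\infty]$ let $s_\gamma(x)=x^\gamma$ for integers $x\ge 1$ and $s_\gamma(0)=1$ (so $s_\infty(1)=1$ and $s_\infty(x)=\infty$ for $x\ge 2$). Let $\mathcal S_{\searrow}$ be the set of score functions $s$ such that, on the positive integers, $s$ is weakly increasing, $1/s$ is discrete-convex (that is, $f(x+2)-f(x+1)\ge f(x+1)-f(x)$ for $f=1/s$ and all $x\ge1$), $s(1)=1$, $s(x)>1$ for some $x$, and $x/s(x)$ is weakly decreasing. A vector $p\in\Delta$ is a *symmetric equilibrium* for $(n,\mathbf d,s)$ if $U(p',p)\le U(p,p)$ for all $p'\in\Delta$, where $$U(p',p)=\sum_{k=1}^K p'_k\,\mathbf d_k\,\mathbb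 E\!\left[\frac1{s(1+X(n-1,p_k))}\right],$$ and a *symmetric optimum* if it maximizes $W$ over $\Delta$, where $$W(p)=\sum_{k=1}^K\mathbf d_k\Pr[X(n,p_k)>0]\ \text{ if } s\in\mathcal S_{\searrow},\qquad W(p)=\sum_{k=1}^K\mathbf d_k\,\mathbb E\!\left[\frac{X(n,p_k)}{s(X(n,p_k))}\right]\ \text{ otherwise.}$$ Put $p^\dagger(\gamma)_k=\mathbf d_k^{1/\gamma}\big/\sum_{k'=1}^K\mathbf d_{k'}^{1/\gamma}$, where $1/\infty=0$. *Claim.* In each of the following cases, for every $n\ge2$ the symmetric equilibrium (respectively optimum) exists and is unique, and the stated convergence holds as $n\to\infty$. 1. Let $\gamma\in(0,\infty]$. The symmetric equilibrium for $(n,\mathbf d,s_\gamma)$ converges to $p^\dagger(\gamma)$; in the case $\gamma=\infty$, the convergence is claimed when all $\mathbf d_k>0$. 2. Let $0<\gamma<1$. The symmetric optimum for $(n,\mathbf d,s_\gamma)$ converges to $p^\dagger(\gamma)$. 3. Let $s\in\mathcal S_{\searrow}$ be arbitrary, or let $s=s_\gamma$ with $1\le\gamma\le\infty$. If all $\mathbf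 d_k>0$, the symmetric optimum for $(n,\mathbf d,s)$ converges to the uniform distribution $(1/K,\dots,1/K)$. In each case the convergence is at the rate $O\!\left(\sqrt{\log n/n}\right)$: for every $k$, the absolute difference of the $k$-th coordinates is $O\!\left(\sqrt{\log n/n}\right)$ as $n\to\infty$. -/

import Mathlib

open Filter Topology Asymptotics
open scoped ENNReal

noncomputable section

namespace ContentGame

/-- The expectation of `f X` for a binomial random variable `X` with parameters `n` and `p`. -/
def binomExpect (n : ℕ) (p : ℝ) (f : ℕ → ℝ) : ℝ :=
  ∑ j ∈ Finset.range (n + 1), (n.choose j : ℝ) * p ^ j * (1 - p) ^ (n - j) * f j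

/-- The strategy space `Δ(π)` for the ranking `π = [1, 2, …, K]`: the probability distributions
on the `K` types whose probabilities are weakly decreasing in the type. -/
def strategies (K : ℕ) : Set (Fin K → ℝ) :=
  {p | (∀ k, 0 ≤ p k) ∧ ∑ k, p k = 1 ∧ Antitone p}

/-- `1 / s x` as a real number, with `1 / ∞ = 0`. Score functions take values in `[0, ∞]`, so that
the score function `x ^ ∞` is allowed. -/
def recip (s : ℕ → ℝ≥0∞) (x : ℕ) : ℝ := ((s x)⁻¹).toReal

/-- `x / s x` as a real number. -/
def ratio (s : ℕ → ℝ≥0∞) (x : ℕ) : ℝ := (x : ℝ) * recip s x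

/-- The class `𝒮↘` of score functions: `s` is (weakly) increasing on the positive integers, `1 / s`
is discrete-convex there, `s 1 = 1`, `s x > 1` for some `x`, and `x / s x` is (weakly) decreasing
on the positive integers. -/
structure IsDownScore (s : ℕ → ℝ≥0∞) : Prop where
  mono : ∀ x y : ℕ, 1 ≤ x → x ≤ y → s x ≤ s y
  convex : ∀ x : ℕ, 1 ≤ x →
    recip s (x + 1) - recip s x ≤ recip s (x + 2) - recip s (x + 1)
  one : s 1 = 1
  exists_gt : ∃ x : ℕ, 1 ≤ x ∧ 1 < s x
  ratio_anti : ∀ x y : ℕ, 1 ≤ x → x ≤ y → ratio s y ≤ ratio s x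

/-- The score function `s_γ x = x ^ γ` for `γ ∈ (0, ∞]`, with the convention `s_γ 0 = 1`.
For `γ = ∞` it is `1` at `x = 1` and `∞` at every `x ≥ 2`. -/
def powerScore (γ : ℝ≥0∞) (x : ℕ) : ℝ≥0∞ :=
  if x ≤ 1 then 1 else if γ = ⊤ then ⊤ else (x : ℝ≥0∞) ^ γ.toReal

/-- `U(p', p; n, d, s)`: the expected utility of a player who plays `p'` while the `n - 1` other
players all play `p`. -/
def utility {K : ℕ} (n : ℕ) (d : Fin K → ℝ) (s : ℕ → ℝ≥0∞) (p' p : Fin K → ℝ) : ℝ :=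
  ∑ k, p' k * d k * binomExpect (n - 1) (p k) (fun x => recip s (1 + x))

open Classical in
/-- `W(p; n, d, s)`: the expected social welfare when all `n` players play `p`. For `s ∈ 𝒮↘` it is
the expected total value of the types that are produced, otherwise it is the expected total
utility of the players. -/
def welfare {K : ℕ} (n : ℕ) (d : Fin K → ℝ) (s : ℕ → ℝ≥0∞) (p : Fin K → ℝ) : ℝ :=
  if IsDownScore s then
    ∑ k, d k * binomExpect n (p k) (fun x => if 0 < x then 1 else 0)
  else
    ∑ k, d k * binomExpect n (p k) (fun x => ratio s x)

/-- `p` is a symmetric equilibrium of the `n`-player game. -/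
def IsSymmEquilibrium {K : ℕ} (n : ℕ) (d : Fin K → ℝ) (s : ℕ → ℝ≥0∞) (p : Fin K → ℝ) : Prop :=
  p ∈ strategies K ∧ ∀ p' ∈ strategies K, utility n d s p' p ≤ utility n d s p p

/-- `p` is a symmetric socially optimal strategy of the `n`-player game. -/
def IsSymmOptimum {K : ℕ} (n : ℕ) (d : Fin K → ℝ) (s : ℕ → ℝ≥0∞) (p : Fin K → ℝ) : Prop :=
  p ∈ strategies K ∧ ∀ p' ∈ strategies K, welfare n d s p' ≤ welfare n d s p

/-- `p†(γ)`, proportional to `d_k ^ (1 / γ)`, where `1 / ∞ = 0`. -/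
def pDagger {K : ℕ} (d : Fin K → ℝ) (γ : ℝ≥0∞) (k : Fin K) : ℝ :=
  d k ^ (γ⁻¹).toReal / ∑ k', d k' ^ (γ⁻¹).toReal

/-- `p n` converges to `q` as `n → ∞`, at the rate `O(√(log n / n))`. -/
def ConvergesAtRate {K : ℕ} (p : ℕ → Fin K → ℝ) (q : Fin K → ℝ) : Prop :=
  Tendsto p atTop (𝓝 q) ∧
    ∀ k, (fun n : ℕ => p n k - q k) =O[atTop] (fun n : ℕ => √(Real.log n / n))

end ContentGame

end

namespace ContentGame

lemma binomExpect_zero (p : ℝ) (f : ℕ → ℝ) : binomExpect 0 p f = f 0 := by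
  simp [binomExpect]

/-- Conditioning on the first trial. -/
lemma binomExpect_succ (n : ℕ) (p : ℝ) (f : ℕ → ℝ) :
    binomExpect (n + 1) p f =
      (1 - p) * binomExpect n p f + p * binomExpect n p (fun x => f (x + 1)) := by
  have h1 : binomExpect n p f = (1 - p) ^ n * f 0 + ∑ j ∈ Finset.range (n + 1),
      (n.choose (j + 1) : ℝ) * p ^ (j + 1) * (1 - p) ^ (n - (j + 1)) * f (j + 1) := by
    unfold binomExpect
    rw [Finset.sum_range_succ', Finset.sum_range_succ (n := n)]
    simp
    ring
  rw [h1]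
  unfold binomExpect
  rw [Finset.sum_range_succ', mul_add, Finset.mul_sum, Finset.mul_sum, add_assoc, add_comm,
    ← Finset.sum_add_distrib]
  congr 1
  · simp
    ring
  · refine Finset.sum_congr rfl fun j hj => ?_
    rw [Nat.choose_succ_succ, Nat.succ_sub_succ]
    push_cast
    rcases (Nat.lt_succ_iff.1 (Finset.mem_range.1 hj)).lt_or_eq with h | rfl
    · have : n - j = (n - (j + 1)) + 1 := by omega
      rw [this]
      ring
    · simp
      ring

lemma binomExpect_mono {n : ℕ} {p : ℝ} (hp0 : 0 ≤ p) (hp1 : p ≤ 1) {f g : ℕ → ℝ}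
    (h : ∀ x ≤ n, f x ≤ g x) : binomExpect n p f ≤ binomExpect n p g := by
  refine Finset.sum_le_sum fun j hj => mul_le_mul_of_nonneg_left (h j ?_) ?_
  · have := Finset.mem_range.1 hj
    omega
  · have : 0 ≤ 1 - p := by linarith
    positivity

lemma binomExpect_add (n : ℕ) (p : ℝ) (f g : ℕ → ℝ) :
    binomExpect n p (fun x => f x + g x) = binomExpect n p f + binomExpect n p g := by
  simp only [binomExpect, mul_add, Finset.sum_add_distrib]

lemma binomExpect_sub (n : ℕ) (p : ℝ) (f g : ℕ → ℝ) :
    binomExpect n p (fun x => f x - g x) = binomExpect n p f - binomExpect n p g := by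
  simp only [binomExpect, mul_sub, Finset.sum_sub_distrib]

lemma binomExpect_const_mul (n : ℕ) (p c : ℝ) (f : ℕ → ℝ) :
    binomExpect n p (fun x => c * f x) = c * binomExpect n p f := by
  simp only [binomExpect, Finset.mul_sum]
  exact Finset.sum_congr rfl fun j _ => by ring

lemma binomExpect_const (n : ℕ) (p c : ℝ) : binomExpect n p (fun _ => c) = c := by
  induction n with
  | zero => rw [binomExpect_zero]
  | succ n ih => rw [binomExpect_succ, ih]; ring

lemma binomExpect_nonneg {n : ℕ} {p : ℝ} (hp0 : 0 ≤ p) (hp1 : p ≤ 1) {f : ℕ → ℝ}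
    (h : ∀ x, 0 ≤ f x) : 0 ≤ binomExpect n p f := by
  simpa only [binomExpect_const] using
    binomExpect_mono (n := n) hp0 hp1 (f := fun _ => 0) (g := f) fun x _ => h x

lemma abs_binomExpect_le {n : ℕ} {p : ℝ} (hp0 : 0 ≤ p) (hp1 : p ≤ 1) (f : ℕ → ℝ) :
    |binomExpect n p f| ≤ binomExpect n p (fun x => |f x|) := by
  refine abs_le.2 ⟨?_, binomExpect_mono hp0 hp1 fun x _ => le_abs_self _⟩
  have := binomExpect_mono (n := n) hp0 hp1 (f := fun x => (-1) * |f x|) (g := f)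
    fun x _ => by linarith [neg_abs_le (f x)]
  rw [binomExpect_const_mul] at this
  linarith

lemma binomExpect_indicator_zero (n : ℕ) (p : ℝ) :
    binomExpect n p (fun x => if x = 0 then 1 else 0) = (1 - p) ^ n := by
  induction n with
  | zero => simp [binomExpect_zero]
  | succ n ih =>
    rw [binomExpect_succ, ih]
    simp only [Nat.add_eq_zero_iff, one_ne_zero, and_false, if_false, binomExpect_const]
    ring

lemma hasDerivAt_binomExpect (n : ℕ) (f : ℕ → ℝ) (p : ℝ) :
    HasDerivAt (fun p => binomExpect (n + 1) p f)
      ((n + 1) * binomExpect n p (fun x => f (x + 1) - f x)) p := by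
  induction n generalizing f with
  | zero =>
    simp only [binomExpect_succ, binomExpect_zero]
    refine ((((hasDerivAt_id p).const_sub 1).mul_const (f 0)).add
      ((hasDerivAt_id p).mul_const (f (0 + 1)))).congr_deriv ?_
    simp
    ring
  | succ n ih =>
    have hid := hasDerivAt_id p
    have h := ((hid.const_sub 1).mul (ih f)).add (hid.mul (ih fun x => f (x + 1)))
    have e : (fun p => binomExpect (n + 1 + 1) p f) = ((fun p => 1 - p) * fun p =>
        binomExpect (n + 1) p f) + id * fun p => binomExpect (n + 1) p fun x => f (x + 1) := by
      ext p
      simp [binomExpect_succ (n + 1)]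
    rw [e]
    refine h.congr_deriv ?_
    rw [binomExpect_sub (n + 1), binomExpect_succ n p f,
      binomExpect_succ n p fun x => f (x + 1)]
    simp only [binomExpect_sub, id]
    push_cast
    ring

lemma continuous_binomExpect (n : ℕ) (f : ℕ → ℝ) : Continuous fun p => binomExpect n p f := by
  unfold binomExpect
  fun_prop

lemma strictAntiOn_binomExpect {n : ℕ} (hn : n ≠ 0) {a : ℕ → ℝ} (ha : Antitone a)
    (ha1 : a 1 < a 0) : StrictAntiOn (fun p => binomExpect n p a) (Set.Icc 0 1) := by
  obtain ⟨n, rfl⟩ := Nat.exists_eq_succ_of_ne_zero hn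
  refine strictAntiOn_of_deriv_neg (convex_Icc 0 1) (continuous_binomExpect _ _).continuousOn ?_
  intro p hp
  rw [interior_Icc] at hp
  rw [(hasDerivAt_binomExpect n a p).deriv]
  refine mul_neg_of_pos_of_neg (by positivity) ?_
  have := binomExpect_mono (n := n) hp.1.le hp.2.le (f := fun x => a (x + 1) - a x)
    (g := fun x => (a 1 - a 0) * if x = 0 then 1 else 0) fun x _ => by
      by_cases hx : x = 0
      · simp [hx]
      · simpa [hx] using ha (Nat.le_succ x)
  rw [binomExpect_const_mul, binomExpect_indicator_zero] at this
  refine this.trans_lt (mul_neg_of_neg_of_pos (by linarith) (pow_pos (by linarith [hp.2]) _))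

lemma binomExpect_sq_add (n : ℕ) (p t : ℝ) :
    binomExpect n p (fun x => ((x : ℝ) + t) ^ 2) = (n * p + t) ^ 2 + n * p * (1 - p) := by
  induction n generalizing t with
  | zero => simp [binomExpect_zero]
  | succ n ih =>
    have h : (fun x : ℕ => (((x + 1 : ℕ) : ℝ) + t) ^ 2) = fun x : ℕ => ((x : ℝ) + (1 + t)) ^ 2 := by
      ext x
      push_cast
      ring
    rw [binomExpect_succ, h, ih, ih]
    push_cast
    ring

lemma binomExpect_sq_sub_le {n : ℕ} {p : ℝ} (hp0 : 0 ≤ p) (hp1 : p ≤ 1) :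
    binomExpect n p (fun x => (((x : ℝ) + 1) / (n + 1) - p) ^ 2) ≤ 1 / (n + 1) := by
  have h : (fun x : ℕ => (((x : ℝ) + 1) / (n + 1) - p) ^ 2) =
      fun x : ℕ => (1 / ((n : ℝ) + 1) ^ 2) * ((x : ℝ) + (1 - (n + 1) * p)) ^ 2 := by
    ext x
    field_simp
    ring
  rw [h, binomExpect_const_mul, binomExpect_sq_add, div_mul_eq_mul_div, div_le_div_iff₀
    (by positivity) (by positivity)]
  have hn : (0 : ℝ) ≤ n := n.cast_nonneg
  have h1 : (n * p + (1 - (n + 1) * p)) ^ 2 ≤ 1 := by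
    have : (n * p + (1 - (n + 1) * p)) = 1 - p := by ring
    rw [this]
    nlinarith
  have h2 : n * p * (1 - p) ≤ n := by nlinarith [mul_nonneg hn hp0, mul_nonneg hn (sq_nonneg p)]
  nlinarith

/-- Size biasing. -/
lemma succ_mul_binomExpect (n : ℕ) (p : ℝ) (g : ℕ → ℝ) :
    (n + 1) * p * binomExpect n p (fun x => g (x + 1) / (x + 1)) =
      binomExpect (n + 1) p (fun x => if x = 0 then 0 else g x) := by
  unfold binomExpect
  rw [Finset.sum_range_succ' _ (n + 1), Finset.mul_sum]
  simp only [Nat.add_eq_zero_iff, one_ne_zero, and_false, if_false, if_true, mul_zero, add_zero]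
  refine Finset.sum_congr rfl fun j _ => ?_
  have h : ((n : ℝ) + 1) * n.choose j = (n + 1).choose (j + 1) * (j + 1) := by
    exact_mod_cast Nat.add_one_mul_choose_eq n j
  have hj : (j : ℝ) + 1 ≠ 0 := by positivity
  rw [Nat.succ_sub_succ]
  field_simp
  linear_combination p ^ j * (1 - p) ^ (n - j) * p * g (j + 1) * h

lemma exists_binomExpect_inv_pow_le (m : ℕ) : ∃ c : ℝ, 0 ≤ c ∧ ∀ (n : ℕ) (p : ℝ), 0 < p → p ≤ 1 →
    binomExpect n p (fun x => (((x : ℝ) + 1) ^ m)⁻¹) ≤ c / ((n + 1) * p) ^ m := by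
  induction m with
  | zero => exact ⟨1, zero_le_one, fun n p _ _ => by simp [binomExpect_const]⟩
  | succ m ih =>
    obtain ⟨c, hc, h⟩ := ih
    refine ⟨2 ^ m * c, by positivity, fun n p hp0 hp1 => ?_⟩
    have h1 := succ_mul_binomExpect n p (fun x => ((x : ℝ) ^ m)⁻¹)
    have e : (fun x : ℕ => (((x + 1 : ℕ) : ℝ) ^ m)⁻¹ / ((x : ℝ) + 1)) =
        fun x : ℕ => (((x : ℝ) + 1) ^ (m + 1))⁻¹ := by
      ext x
      push_cast
      rw [pow_succ, mul_inv, div_eq_mul_inv]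
    rw [e] at h1
    have h2 : binomExpect (n + 1) p (fun x => if x = 0 then 0 else ((x : ℝ) ^ m)⁻¹) ≤
        binomExpect (n + 1) p (fun x => 2 ^ m * (((x : ℝ) + 1) ^ m)⁻¹) := by
      refine binomExpect_mono hp0.le hp1 fun x _ => ?_
      split_ifs with hx
      · positivity
      · have hx1 : (1 : ℝ) ≤ x := by exact_mod_cast Nat.one_le_iff_ne_zero.2 hx
        rw [← div_eq_mul_inv, ← one_div, div_le_div_iff₀ (by positivity) (by positivity), one_mul,
          ← mul_pow]
        exact pow_le_pow_left₀ (by positivity) (by linarith) _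
    rw [binomExpect_const_mul] at h2
    have h3 := h (n + 1) p hp0 hp1
    have h4 : c / (((n + 1 : ℕ) + 1) * p) ^ m ≤ c / ((n + 1) * p) ^ m := by
      gcongr
      linarith
    rw [pow_succ, le_div_iff₀ (by positivity)]
    have h5 : 2 ^ m * binomExpect (n + 1) p (fun x => (((x : ℝ) + 1) ^ m)⁻¹) ≤
        2 ^ m * (c / ((n + 1) * p) ^ m) := by
      gcongr
      exact h3.trans h4
    have h6 := (h1.trans_le h2).trans h5
    rw [← mul_div_assoc, le_div_iff₀ (by positivity)] at h6
    linarith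

/-- Moments of `(n + 1) / (X + 1)`. -/
lemma exists_binomExpect_div_pow_le (m : ℕ) : ∃ c : ℝ, 0 ≤ c ∧ ∀ (n : ℕ) (p : ℝ), 0 < p → p ≤ 1 →
    binomExpect n p (fun x => (((n : ℝ) + 1) / ((x : ℝ) + 1)) ^ m) ≤ c / p ^ m := by
  obtain ⟨c, hc, h⟩ := exists_binomExpect_inv_pow_le m
  refine ⟨c, hc, fun n p hp0 hp1 => ?_⟩
  have h1 := mul_le_mul_of_nonneg_left (h n p hp0 hp1)
    (by positivity : (0 : ℝ) ≤ ((n : ℝ) + 1) ^ m)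
  rw [← binomExpect_const_mul] at h1
  simp only [← div_eq_mul_inv, ← div_pow] at h1
  refine h1.trans_eq ?_
  rw [mul_pow]
  field_simp

section

variable {K : ℕ} {d : Fin K → ℝ} {h f : ℝ → ℝ} {p q : Fin K → ℝ}

/-- `p` solves the variational inequality on `C` with marginal values `d k * h (p k)`. -/
def IsVarSolution (C : Set (Fin K → ℝ)) (d : Fin K → ℝ) (h : ℝ → ℝ) (p : Fin K → ℝ) : Prop :=
  p ∈ C ∧ ∀ p' ∈ C, ∑ k, p' k * d k * h (p k) ≤ ∑ k, p k * d k * h (p k)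

lemma isVarSolution_of_max {C : Set (Fin K → ℝ)} (hC : Convex ℝ C)
    (hf : ∀ x, HasDerivAt f (h x) x) (hp : p ∈ C)
    (hmax : ∀ p' ∈ C, ∑ k, d k * f (p' k) ≤ ∑ k, d k * f (p k)) : IsVarSolution C d h p := by
  refine ⟨hp, fun p' hp' => ?_⟩
  have hder : HasDerivAt (fun t : ℝ => ∑ k, d k * f (p k + t * (p' k - p k)))
      (∑ k, d k * (h (p k) * (p' k - p k))) 0 := by
    refine HasDerivAt.fun_sum fun k _ => HasDerivAt.const_mul _ ?_
    have h1 : HasDerivAt (fun t : ℝ => p k + t * (p' k - p k)) (p' k - p k) 0 := by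
      simpa using ((hasDerivAt_id (0 : ℝ)).mul_const (p' k - p k)).const_add (p k)
    have h2 : HasDerivAt f (h (p k)) (p k + 0 * (p' k - p k)) := by
      simpa using hf (p k)
    exact h2.comp (0 : ℝ) h1
  have hle : ∑ k, d k * (h (p k) * (p' k - p k)) ≤ 0 := by
    refine le_of_tendsto hder.tendsto_slope_zero_right ?_
    filter_upwards [Ioo_mem_nhdsGT (zero_lt_one' ℝ)] with t ht
    rw [smul_eq_mul]
    refine mul_nonpos_of_nonneg_of_nonpos (inv_nonneg.2 ht.1.le) ?_
    have h1 := hmax (fun k => p k + t * (p' k - p k)) (by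
      have := hC.add_smul_sub_mem hp hp' ⟨ht.1.le, ht.2.le⟩
      exact this)
    simpa using h1
  rw [← sub_nonpos, ← Finset.sum_sub_distrib]
  refine le_of_eq_of_le (Finset.sum_congr rfl fun k _ => ?_) hle
  ring

lemma strategies_subset_stdSimplex : strategies K ⊆ stdSimplex ℝ (Fin K) :=
  fun _ hp => ⟨hp.1, hp.2.1⟩

lemma le_one_of_mem_stdSimplex (hp : p ∈ stdSimplex ℝ (Fin K)) (k : Fin K) : p k ≤ 1 :=
  (mem_Icc_of_mem_stdSimplex hp k).2

lemma convex_strategies : Convex ℝ (strategies K) := by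
  intro p hp q hq a b ha hb hab
  have h := convex_stdSimplex ℝ (Fin K) (strategies_subset_stdSimplex hp)
    (strategies_subset_stdSimplex hq) ha hb hab
  refine ⟨h.1, h.2, fun i j hij => ?_⟩
  have h1 := mul_le_mul_of_nonneg_left (hp.2.2 hij) ha
  have h2 := mul_le_mul_of_nonneg_left (hq.2.2 hij) hb
  simpa using add_le_add h1 h2

lemma isCompact_strategies : IsCompact (strategies K) := by
  have : strategies K = stdSimplex ℝ (Fin K) ∩ {p | Antitone p} := by
    ext p
    exact ⟨fun hp => ⟨⟨hp.1, hp.2.1⟩, hp.2.2⟩, fun hp => ⟨hp.1.1, hp.1.2, hp.2⟩⟩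
  rw [this]
  exact (isCompact_stdSimplex ℝ (Fin K)).inter_right isClosed_antitone

lemma exists_max {C : Set (Fin K → ℝ)} (hC : IsCompact C) (hne : C.Nonempty) (hf : Continuous f) :
    ∃ p ∈ C, ∀ p' ∈ C, ∑ k, d k * f (p' k) ≤ ∑ k, d k * f (p k) :=
  hC.exists_isMaxOn hne (f := fun p : Fin K → ℝ => ∑ k, d k * f (p k)) (by fun_prop)

/-- If a strategy puts mass on a type, then no other type has a larger marginal value. -/
lemma IsVarSolution.le_of_pos (hp : IsVarSolution (stdSimplex ℝ (Fin K)) d h p) {j : Fin K}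
    (hj : 0 < p j) (k : Fin K) : d k * h (p k) ≤ d j * h (p j) := by
  rcases eq_or_ne k j with rfl | hkj
  · rfl
  have hmem : p + p j • (Pi.single k (1 : ℝ) - Pi.single j 1) ∈ stdSimplex ℝ (Fin K) := by
    refine ⟨fun i => ?_, ?_⟩
    · rcases eq_or_ne i j with rfl | hij
      · simp [hkj.symm]
      · have := hp.1.1 i
        rcases eq_or_ne i k with rfl | hik
        · simp only [Pi.add_apply, Pi.smul_apply, Pi.sub_apply, Pi.single_eq_same,
            Pi.single_eq_of_ne hij, smul_eq_mul]
          linarith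
        · simpa [hij, hik] using this
    · simp [Finset.sum_add_distrib, ← Finset.mul_sum, hp.1.2]
  have h1 := hp.2 _ hmem
  simp only [Pi.add_apply, Pi.smul_apply, Pi.sub_apply, smul_eq_mul, add_mul,
    Finset.sum_add_distrib, add_le_iff_nonpos_right] at h1
  simp only [sub_mul, mul_sub, Finset.sum_sub_distrib, Pi.single_apply, mul_ite, ite_mul, mul_one,
    mul_zero, zero_mul, Finset.sum_ite_eq', Finset.mem_univ, if_true] at h1
  have h2 : p j * (d k * h (p k)) ≤ p j * (d j * h (p j)) := by linarith
  exact le_of_mul_le_mul_left h2 hj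

/-- The properties of the marginal value function that the existence and uniqueness of
solutions rest on. -/
structure IsMarginal (h : ℝ → ℝ) : Prop where
  strictAnti : StrictAntiOn h (Set.Icc 0 1)
  nonneg : 0 ≤ h 1

lemma IsMarginal.pos (hh : IsMarginal h) {x : ℝ} (h0 : 0 ≤ x) (h1 : x < 1) : 0 < h x :=
  hh.nonneg.trans_lt (hh.strictAnti ⟨h0, h1.le⟩ ⟨zero_le_one, le_rfl⟩ h1)

lemma lt_one_of_pos (hp : p ∈ stdSimplex ℝ (Fin K)) {i j : Fin K} (hij : i ≠ j) (hj : 0 < p j) :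
    p i < 1 := by
  have h1 : ∑ k ∈ {i, j}, p k ≤ ∑ k, p k :=
    Finset.sum_le_sum_of_subset_of_nonneg (Finset.subset_univ _) fun k _ _ => hp.1 k
  rw [Finset.sum_pair hij, hp.2] at h1
  linarith

lemma exists_pos_of_ne_zero (hd0 : ∀ k, 0 ≤ d k) (hne : d ≠ 0) : ∃ i, 0 < d i := by
  obtain ⟨i, hi⟩ := Function.ne_iff.1 hne
  exact ⟨i, (hd0 i).lt_of_ne' hi⟩

lemma IsVarSolution.pos_of_pos (hh : IsMarginal h) (hd0 : ∀ k, 0 ≤ d k) (hne : d ≠ 0)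
    (hp : IsVarSolution (stdSimplex ℝ (Fin K)) d h p) {j : Fin K} (hj : 0 < p j) : 0 < d j := by
  refine (hd0 j).lt_of_ne' fun hdj => ?_
  obtain ⟨i, hi⟩ := exists_pos_of_ne_zero hd0 hne
  have hij : i ≠ j := by
    rintro rfl
    exact hi.ne' hdj
  have h1 := hp.le_of_pos hj i
  rw [hdj, zero_mul] at h1
  exact h1.not_gt (mul_pos hi (hh.pos (hp.1.1 i) (lt_one_of_pos hp.1 hij hj)))

lemma IsVarSolution.antitone (hh : IsMarginal h) (hd0 : ∀ k, 0 ≤ d k) (hd : Antitone d)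
    (hne : d ≠ 0) (hp : IsVarSolution (stdSimplex ℝ (Fin K)) d h p) : Antitone p := by
  intro k j hkj
  by_contra! hlt
  have hj : 0 < p j := (hp.1.1 k).trans_lt hlt
  have hIcc : ∀ i, p i ∈ Set.Icc (0 : ℝ) 1 := mem_Icc_of_mem_stdSimplex hp.1
  have hdk : 0 < d k := (hp.pos_of_pos hh hd0 hne hj).trans_le (hd hkj)
  have h1 := hp.le_of_pos hj k
  have h2 : h (p j) < h (p k) := hh.strictAnti (hIcc k) (hIcc j) hlt
  have h3 : 0 ≤ h (p j) := hh.nonneg.trans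
    (hh.strictAnti.antitoneOn (hIcc j) ⟨zero_le_one, le_rfl⟩ (hIcc j).2)
  have h4 := mul_le_mul_of_nonneg_right (hd hkj) h3
  have h5 := mul_lt_mul_of_pos_left h2 hdk
  linarith

lemma exists_isVarSolution_stdSimplex (hne : d ≠ 0) (hf : ∀ x, HasDerivAt f (h x) x) :
    ∃ p, IsVarSolution (stdSimplex ℝ (Fin K)) d h p := by
  obtain ⟨i, -⟩ := Function.ne_iff.1 hne
  obtain ⟨p, hp, hmax⟩ := exists_max (d := d) (isCompact_stdSimplex ℝ (Fin K))
    ⟨_, single_mem_stdSimplex ℝ i⟩ (continuous_iff_continuousAt.2 fun x => (hf x).continuousAt)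
  exact ⟨p, isVarSolution_of_max (convex_stdSimplex ℝ (Fin K)) hf hp hmax⟩

lemma IsVarSolution.strategies (hh : IsMarginal h) (hd0 : ∀ k, 0 ≤ d k) (hd : Antitone d)
    (hne : d ≠ 0) (hp : IsVarSolution (stdSimplex ℝ (Fin K)) d h p) :
    IsVarSolution (strategies K) d h p :=
  ⟨⟨hp.1.1, hp.1.2, hp.antitone hh hd0 hd hne⟩,
    fun p' hp' => hp.2 p' (strategies_subset_stdSimplex hp')⟩

/-- Two solutions agree on the types of positive value. -/
lemma IsVarSolution.eq_of_pos {C : Set (Fin K → ℝ)} (hC : C ⊆ stdSimplex ℝ (Fin K))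
    (hh : IsMarginal h) (hd0 : ∀ k, 0 ≤ d k) (hp : IsVarSolution C d h p)
    (hq : IsVarSolution C d h q) {k : Fin K} (hk : 0 < d k) : p k = q k := by
  have hterm : ∀ i, 0 ≤ d i * ((q i - p i) * (h (p i) - h (q i))) := fun i => by
    refine mul_nonneg (hd0 i) ?_
    have hpi := mem_Icc_of_mem_stdSimplex (hC hp.1) i
    have hqi := mem_Icc_of_mem_stdSimplex (hC hq.1) i
    rcases le_total (p i) (q i) with hle | hle
    · exact mul_nonneg (sub_nonneg.2 hle) (sub_nonneg.2 (hh.strictAnti.antitoneOn hpi hqi hle))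
    · exact mul_nonneg_of_nonpos_of_nonpos (sub_nonpos.2 hle)
        (sub_nonpos.2 (hh.strictAnti.antitoneOn hqi hpi hle))
  have hsum : ∑ i, d i * ((q i - p i) * (h (p i) - h (q i))) ≤ 0 := by
    have h1 := hp.2 q hq.1
    have h2 := hq.2 p hp.1
    have h3 : ∑ i, d i * ((q i - p i) * (h (p i) - h (q i))) =
        (∑ i, q i * d i * h (p i) - ∑ i, p i * d i * h (p i)) +
        (∑ i, p i * d i * h (q i) - ∑ i, q i * d i * h (q i)) := by
      rw [← Finset.sum_sub_distrib, ← Finset.sum_sub_distrib, ← Finset.sum_add_distrib]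
      exact Finset.sum_congr rfl fun i _ => by ring
    linarith
  have h0 := (Finset.sum_eq_zero_iff_of_nonneg fun i _ => hterm i).1
    (le_antisymm hsum (Finset.sum_nonneg fun i _ => hterm i)) k (Finset.mem_univ k)
  rcases mul_eq_zero.1 h0 with h1 | h1
  · exact absurd h1 hk.ne'
  rcases mul_eq_zero.1 h1 with h2 | h2
  · linarith
  · exact hh.strictAnti.injOn (mem_Icc_of_mem_stdSimplex (hC hp.1) k)
      (mem_Icc_of_mem_stdSimplex (hC hq.1) k) (by linarith)

lemma IsVarSolution.eq_of_stdSimplex (hh : IsMarginal h) (hd0 : ∀ k, 0 ≤ d k) (hd : Antitone d)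
    (hne : d ≠ 0) (hp : IsVarSolution (stdSimplex ℝ (Fin K)) d h p)
    (hq : IsVarSolution (ContentGame.strategies K) d h q) : q = p := by
  have heq : ∀ k, 0 < d k → q k = p k := fun k hk =>
    hq.eq_of_pos strategies_subset_stdSimplex hh hd0 (hp.strategies hh hd0 hd hne) hk
  have hp0 : ∀ k, ¬ 0 < d k → p k = 0 := fun k hk =>
    le_antisymm (not_lt.1 fun h1 => hk (hp.pos_of_pos hh hd0 hne h1)) (hp.1.1 k)
  have hle : ∀ k, p k ≤ q k := fun k => by
    by_cases hk : 0 < d k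
    · exact (heq k hk).ge
    · exact (hp0 k hk).trans_le (hq.1.1 k)
  have hs := (Finset.sum_eq_sum_iff_of_le fun k _ => hle k).1 (hp.1.2.trans hq.1.2.1.symm)
  exact funext fun k => (hs k (Finset.mem_univ k)).symm

lemma existsUnique_isVarSolution (hh : IsMarginal h) (hd0 : ∀ k, 0 ≤ d k) (hd : Antitone d)
    (hne : d ≠ 0) (hf : ∀ x, HasDerivAt f (h x) x) :
    ∃! p, IsVarSolution (strategies K) d h p := by
  obtain ⟨p, hp⟩ := exists_isVarSolution_stdSimplex hne hf
  exact ⟨p, hp.strategies hh hd0 hd hne, fun q hq => hp.eq_of_stdSimplex hh hd0 hd hne hq⟩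

lemma IsVarSolution.stdSimplex (hh : IsMarginal h) (hd0 : ∀ k, 0 ≤ d k) (hd : Antitone d)
    (hne : d ≠ 0) (hf : ∀ x, HasDerivAt f (h x) x)
    (hq : IsVarSolution (ContentGame.strategies K) d h q) :
    IsVarSolution (_root_.stdSimplex ℝ (Fin K)) d h q := by
  obtain ⟨p, hp⟩ := exists_isVarSolution_stdSimplex hne hf
  rwa [hp.eq_of_stdSimplex hh hd0 hd hne hq]

lemma isMarginal_binomExpect {n : ℕ} (hn : n ≠ 0) {a : ℕ → ℝ} (ha : Antitone a)
    (ha0 : ∀ x, 0 ≤ a x) (ha1 : a 1 < a 0) : IsMarginal (fun x => binomExpect n x a) :=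
  ⟨strictAntiOn_binomExpect hn ha ha1, binomExpect_nonneg zero_le_one le_rfl ha0⟩

lemma hasDerivAt_antideriv_binomExpect (n : ℕ) (a : ℕ → ℝ) (x : ℝ) :
    HasDerivAt (fun x => binomExpect (n + 1) x (fun j => ∑ i ∈ Finset.range j, a i) / (n + 1))
      (binomExpect n x a) x := by
  refine ((hasDerivAt_binomExpect n _ x).div_const _).congr_deriv ?_
  simp only [Finset.sum_range_succ, add_sub_cancel_left]
  field_simp

end

section

variable {K : ℕ} {d : Fin K → ℝ}

lemma rpow_le_rpow_add_rpow {x a b : ℝ} (ha : 0 < a) (hax : a ≤ x) (hxb : x ≤ b) (s : ℝ) :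
    x ^ s ≤ a ^ s + b ^ s := by
  have hx : 0 < x := ha.trans_le hax
  have hb : 0 < b := hx.trans_le hxb
  rcases le_total 0 s with hs | hs
  · have := Real.rpow_le_rpow hx.le hxb hs
    have := Real.rpow_nonneg ha.le s
    linarith
  · have := Real.rpow_le_rpow_of_nonpos ha hax hs
    have := Real.rpow_nonneg hb.le s
    linarith

lemma abs_rpow_sub_rpow_le {x y : ℝ} (hx : 0 < x) (hy : 0 < y) (r : ℝ) :
    |x ^ r - y ^ r| ≤ |r| * |x - y| * (x ^ (r - 1) + y ^ (r - 1)) := by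
  wlog hxy : x < y generalizing x y
  · rcases (not_lt.1 hxy).eq_or_lt with rfl | hlt
    · simp
    · rw [abs_sub_comm, abs_sub_comm x, add_comm]
      exact this hy hx hlt
  obtain ⟨ξ, hξ, hs⟩ := exists_hasDerivAt_eq_slope (fun t : ℝ => t ^ r)
    (fun t => r * t ^ (r - 1)) hxy
    (fun t ht => (Real.continuousAt_rpow_const _ _ (Or.inl (hx.trans_le ht.1).ne')).continuousWithinAt)
    (fun t ht => Real.hasDerivAt_rpow_const (Or.inl (hx.trans ht.1).ne'))
  rw [eq_div_iff (sub_pos.2 hxy).ne'] at hs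
  rw [abs_sub_comm, ← hs, abs_mul, abs_mul, abs_sub_comm y x, mul_right_comm,
    abs_of_nonneg (Real.rpow_nonneg (hx.trans hξ.1).le _)]
  gcongr
  exact rpow_le_rpow_add_rpow hx hξ.1.le hξ.2.le _

/-- If `a x` is asymptotic to a multiple of `(x + 1) ^ (-γ)`, then so is the binomial expectation
of `a` to that of `(n * p) ^ (-γ)`, uniformly for `p` bounded away from zero. -/
lemma exists_abs_binomExpect_sub_le {γ c A ε : ℝ} (hγ : 0 < γ) (hA : 0 ≤ A) (hε : 0 < ε)
    {a : ℕ → ℝ}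
    (ha : ∀ x : ℕ, |a x - c * ((x : ℝ) + 1) ^ (-γ)| ≤ A * ((x : ℝ) + 1) ^ (-γ - 1)) :
    ∃ C, 0 ≤ C ∧ ∀ n : ℕ, 1 ≤ n → ∀ p, ε ≤ p → p ≤ 1 →
      |(n : ℝ) ^ γ * binomExpect (n - 1) p a - c * p ^ (-γ)| ≤ C / √n := by
  obtain ⟨m, hm⟩ := exists_nat_ge (γ + 1)
  obtain ⟨M, hM0, hM⟩ := exists_binomExpect_div_pow_le (2 * m)
  set B := ε ^ (-γ - 1)
  have hB : 0 ≤ B := Real.rpow_nonneg hε.le _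
  set D := |c| * γ * (1 + B)
  have hD : 0 ≤ D := by positivity
  refine ⟨D + (D + A) * (M / ε ^ (2 * m)), by positivity, fun n hn p hεp hp1 => ?_⟩
  obtain ⟨n, rfl⟩ := Nat.exists_eq_add_of_le' hn
  rw [Nat.add_sub_cancel]
  push_cast
  have hp0 : 0 < p := hε.trans_le hεp
  set N : ℝ := n + 1
  have hN : 1 ≤ N := by simp [N]
  have hN0 : 0 < N := by linarith
  have hR : 1 ≤ √N := Real.one_le_sqrt.2 hN
  have hR0 : 0 < √N := by linarith
  have hRR : √N * √N = N := Real.mul_self_sqrt hN0.le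
  have hpt : ∀ x ≤ n, |N ^ γ * a x - c * p ^ (-γ)| ≤
      D * √N * (((x : ℝ) + 1) / N - p) ^ 2 + (D + A) / √N * (N / ((x : ℝ) + 1)) ^ (2 * m) := by
    intro x hx
    set y : ℝ := x + 1
    have hy0 : 0 < y := by positivity
    have hyN : y ≤ N := by
      have : (x : ℝ) ≤ n := by exact_mod_cast hx
      simp only [y, N]
      linarith
    set z := y / N
    have hz0 : 0 < z := by positivity
    have hz1 : z ≤ 1 := (div_le_one hN0).2 hyN
    set w := N / y
    have hw : w = z⁻¹ := (inv_div _ _).symm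
    have hw1 : 1 ≤ w := (one_le_div hy0).2 hyN
    have hwm : 1 ≤ w ^ m := one_le_pow₀ hw1
    have hzs : z ^ (-γ - 1) ≤ w ^ m := by
      have e : z ^ (-γ - 1) = w ^ (γ + 1) := by
        rw [hw, Real.inv_rpow hz0.le, ← Real.rpow_neg hz0.le]
        congr 1
        ring
      rw [e, ← Real.rpow_natCast]
      exact Real.rpow_le_rpow_of_exponent_le hw1 hm
    have hscale : ∀ s : ℝ, N ^ s * y ^ (-s) = z ^ (-s) := fun s => by
      rw [Real.div_rpow hy0.le hN0.le, Real.rpow_neg hN0.le, div_inv_eq_mul, mul_comm]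
    have h1 : |N ^ γ * a x - c * z ^ (-γ)| ≤ A * w ^ m / N := by
      have e : N ^ γ * a x - c * z ^ (-γ) = N ^ γ * (a x - c * y ^ (-γ)) := by
        rw [← hscale]
        ring
      rw [e, abs_mul, abs_of_nonneg (Real.rpow_nonneg hN0.le _), le_div_iff₀ hN0]
      calc N ^ γ * |a x - c * y ^ (-γ)| * N ≤ N ^ γ * (A * y ^ (-γ - 1)) * N := by
            gcongr
            exact ha x
        _ = A * (N ^ (γ + 1) * y ^ (-(γ + 1))) := by
            rw [Real.rpow_add hN0, Real.rpow_one, neg_add']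
            ring
        _ = A * z ^ (-γ - 1) := by rw [hscale, neg_add']
        _ ≤ A * w ^ m := by gcongr
    have h2 : |z ^ (-γ) - p ^ (-γ)| ≤ γ * (1 + B) * (|z - p| * w ^ m) := by
      have h3 := abs_rpow_sub_rpow_le hz0 hp0 (-γ)
      rw [abs_neg, abs_of_pos hγ] at h3
      have h4 : p ^ (-γ - 1) ≤ B := Real.rpow_le_rpow_of_nonpos hε hεp (by linarith)
      have h5 : B ≤ B * w ^ m := le_mul_of_one_le_right hB hwm
      calc _ ≤ _ := h3
        _ ≤ γ * |z - p| * (w ^ m + B * w ^ m) := by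
          gcongr
          linarith
        _ = _ := by ring
    have h6 : |z - p| * w ^ m ≤ √N * (z - p) ^ 2 + w ^ (2 * m) / √N := by
      have h7 : |z - p| * w ^ m * √N ≤ (√N * |z - p|) ^ 2 + (w ^ m) ^ 2 := by
        nlinarith [sq_nonneg (√N * |z - p| - w ^ m), sq_nonneg (√N * |z - p|), sq_nonneg (w ^ m)]
      rw [mul_pow, sq_abs, Real.sq_sqrt hN0.le, ← pow_mul, mul_comm m] at h7
      have h8 : (√N * (z - p) ^ 2 + w ^ (2 * m) / √N) * √N = N * (z - p) ^ 2 + w ^ (2 * m) := by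
        field_simp
        rw [Real.sq_sqrt hN0.le]
        ring
      exact le_of_mul_le_mul_right (h7.trans_eq h8.symm) hR0
    have h9 : A * w ^ m / N ≤ A / √N * w ^ (2 * m) := by
      rw [div_mul_eq_mul_div]
      have hmm : w ^ m ≤ w ^ (2 * m) := pow_le_pow_right₀ hw1 (by omega)
      have hRN : √N ≤ N := by nlinarith
      gcongr
    calc |N ^ γ * a x - c * p ^ (-γ)|
        ≤ |N ^ γ * a x - c * z ^ (-γ)| + |c * z ^ (-γ) - c * p ^ (-γ)| := abs_sub_le _ _ _
      _ = |N ^ γ * a x - c * z ^ (-γ)| + |c| * |z ^ (-γ) - p ^ (-γ)| := by rw [← mul_sub, abs_mul]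
      _ ≤ A / √N * w ^ (2 * m) +
          |c| * (γ * (1 + B) * (√N * (z - p) ^ 2 + w ^ (2 * m) / √N)) := by
        refine add_le_add (h1.trans h9) (mul_le_mul_of_nonneg_left (h2.trans ?_) (abs_nonneg _))
        gcongr
      _ = _ := by
        simp only [D]
        ring
  have e : N ^ γ * binomExpect n p a - c * p ^ (-γ) =
      binomExpect n p (fun x => N ^ γ * a x - c * p ^ (-γ)) := by
    rw [binomExpect_sub, binomExpect_const_mul, binomExpect_const]
  rw [e]
  refine (abs_binomExpect_le hp0.le hp1 _).trans ((binomExpect_mono hp0.le hp1 hpt).trans ?_)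
  rw [binomExpect_add, binomExpect_const_mul, binomExpect_const_mul]
  have hM' := hM n p hp0 hp1
  have hS := binomExpect_sq_sub_le (n := n) hp0.le hp1
  calc _ ≤ D * √N * (1 / N) + (D + A) / √N * (M / ε ^ (2 * m)) := by
        gcongr
        refine hM'.trans ?_
        gcongr
    _ = _ := by
        have : D * √N * (1 / N) = D / √N := by
          rw [mul_one_div, div_eq_div_iff hN0.ne' hR0.ne', mul_assoc, hRR]
        rw [this]
        ring

end

section

variable {K : ℕ} {d : Fin K → ℝ}

lemma exists_inv_le_of_mem_stdSimplex {p : Fin K → ℝ} (hp : p ∈ stdSimplex ℝ (Fin K)) :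
    ∃ j, 1 / (K : ℝ) ≤ p j := by
  by_contra! hlt
  have hK : K ≠ 0 := by
    rintro rfl
    simpa using hp.2
  have : NeZero K := ⟨hK⟩
  have h1 : ∑ k, p k < ∑ _k : Fin K, 1 / (K : ℝ) :=
    Finset.sum_lt_sum_of_nonempty Finset.univ_nonempty fun k _ => hlt k
  rw [hp.2] at h1
  have : (K : ℝ) ≠ 0 := by exact_mod_cast hK
  simp [this] at h1

/-- The probabilities of the types of positive value stay away from zero. -/
lemma exists_eventually_le {γ c : ℝ} (hγ : 0 < γ) (hc : 0 < c) {h : ℕ → ℝ → ℝ}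
    (hh : ∀ n, 2 ≤ n → IsMarginal (h n))
    (hlim : ∀ ε, 0 < ε → ∃ C, 0 ≤ C ∧ ∀ n : ℕ, 1 ≤ n → ∀ x, ε ≤ x → x ≤ 1 →
      |(n : ℝ) ^ γ * h n x - c * x ^ (-γ)| ≤ C / √n)
    (hd0 : ∀ k, 0 ≤ d k) {p : ℕ → Fin K → ℝ}
    (hp : ∀ n, 2 ≤ n → IsVarSolution (stdSimplex ℝ (Fin K)) d (h n) (p n))
    {k : Fin K} (hk : 0 < d k) : ∃ ε, 0 < ε ∧ ∀ᶠ n in atTop, ε ≤ p n k := by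
  have hK0 : (0 : ℝ) < K := by exact_mod_cast k.pos
  have hK1 : 1 / (K : ℝ) ≤ 1 := by
    rw [div_le_one hK0]
    exact_mod_cast k.pos
  have hi0 : 0 < 1 / (K : ℝ) := by positivity
  set D := (∑ i, d i) / d k
  have hD : 0 ≤ D := div_nonneg (Finset.sum_nonneg fun i _ => hd0 i) hk.le
  obtain ⟨ε, hε, hε0, hεK⟩ := (((tendsto_rpow_neg_nhdsGT_zero (neg_neg_of_pos hγ)).eventually_ge_atTop
    ((D * (c * (1 / (K : ℝ)) ^ (-γ)) + 1) / c)).and (Ioo_mem_nhdsGT hi0)).exists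
  rw [div_le_iff₀ hc, mul_comm (ε ^ _)] at hε
  obtain ⟨C₁, hC₁, h1⟩ := hlim ε hε0
  obtain ⟨C₂, hC₂, h2⟩ := hlim (1 / K) hi0
  refine ⟨ε, hε0, ?_⟩
  have hsmall : ∀ᶠ n : ℕ in atTop, (C₁ + D * C₂) / √(n : ℝ) < 1 :=
    ((Real.tendsto_sqrt_atTop.comp tendsto_natCast_atTop_atTop).const_div_atTop
      (C₁ + D * C₂)).eventually_lt_const zero_lt_one
  filter_upwards [hsmall, eventually_ge_atTop 2] with n hs hn
  by_contra! hlt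
  have hanti := (hh n hn).strictAnti.antitoneOn
  have hmem : ∀ i, p n i ∈ Set.Icc (0 : ℝ) 1 := mem_Icc_of_mem_stdSimplex (hp n hn).1
  obtain ⟨j, hj⟩ := exists_inv_le_of_mem_stdSimplex (hp n hn).1
  have h3 := (hp n hn).le_of_pos (hi0.trans_le hj) k
  have h4 : h n (p n j) ≤ h n (1 / K) := hanti ⟨hi0.le, hK1⟩ (hmem j) hj
  have h5 : h n ε ≤ h n (p n k) := hanti (hmem k) ⟨hε0.le, hεK.le.trans hK1⟩ hlt.le
  have h6 : 0 ≤ h n (1 / K) :=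
    (hh n hn).nonneg.trans (hanti ⟨hi0.le, hK1⟩ ⟨zero_le_one, le_rfl⟩ hK1)
  have h7 : h n ε ≤ D * h n (1 / K) := by
    rw [div_mul_eq_mul_div, le_div_iff₀ hk]
    calc h n ε * d k ≤ d k * h n (p n k) := by
          rw [mul_comm]
          gcongr
      _ ≤ d j * h n (p n j) := h3
      _ ≤ d j * h n (1 / K) := mul_le_mul_of_nonneg_left h4 (hd0 j)
      _ ≤ (∑ i, d i) * h n (1 / K) := by
          gcongr
          exact Finset.single_le_sum (fun i _ => hd0 i) (Finset.mem_univ j)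
  have h8 := (abs_le.1 (h1 n (by omega) ε le_rfl (hεK.le.trans hK1))).1
  have h9 := (abs_le.1 (h2 n (by omega) (1 / K) le_rfl hK1)).2
  have h10 := mul_le_mul_of_nonneg_left h7 (Real.rpow_nonneg n.cast_nonneg γ : (0 : ℝ) ≤ (n : ℝ) ^ γ)
  have h11 := mul_le_mul_of_nonneg_left h9 hD
  rw [add_div, mul_div_assoc] at hs
  linarith

lemma exists_forall_pos_le (hd0 : ∃ i, 0 < d i) : ∃ δ, 0 < δ ∧ ∀ k, 0 < d k → δ ≤ d k := by
  obtain ⟨i, hi⟩ := hd0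
  obtain ⟨j, hj, hmin⟩ := Finset.exists_min_image ({k | 0 < d k} : Finset (Fin K)) d ⟨i, by simpa⟩
  exact ⟨d j, by simpa using hj, fun k hk => hmin k (by simpa)⟩

/-- If the marginal values are asymptotic to those of the power `-γ`, then the solutions are
within `O(1 / √n)` of the distribution proportional to `d k ^ (1 / γ)`. -/
lemma exists_eventually_abs_sub_le {γ c : ℝ} (hγ : 0 < γ) (hc : 0 < c) {h : ℕ → ℝ → ℝ}
    (hh : ∀ n, 2 ≤ n → IsMarginal (h n))
    (hlim : ∀ ε, 0 < ε → ∃ C, 0 ≤ C ∧ ∀ n : ℕ, 1 ≤ n → ∀ x, ε ≤ x → x ≤ 1 →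
      |(n : ℝ) ^ γ * h n x - c * x ^ (-γ)| ≤ C / √n)
    (hd0 : ∀ k, 0 ≤ d k) (hne : d ≠ 0) {p : ℕ → Fin K → ℝ}
    (hp : ∀ n, 2 ≤ n → IsVarSolution (stdSimplex ℝ (Fin K)) d (h n) (p n)) :
    ∃ C, ∀ᶠ n : ℕ in atTop, ∀ k, |p n k - d k ^ γ⁻¹ / ∑ i, d i ^ γ⁻¹| ≤ C / √n := by
  obtain ⟨i₀, hi₀⟩ := exists_pos_of_ne_zero hd0 hne
  obtain ⟨δ, hδ, hδd⟩ := exists_forall_pos_le ⟨i₀, hi₀⟩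
  have hev : ∀ k, ∃ ε, 0 < ε ∧ (0 < d k → ∀ᶠ n in atTop, ε ≤ p n k) := fun k => by
    by_cases hk : 0 < d k
    · obtain ⟨ε, hε, h1⟩ := exists_eventually_le hγ hc hh hlim hd0 hp hk
      exact ⟨ε, hε, fun _ => h1⟩
    · exact ⟨1, one_pos, fun h1 => absurd h1 hk⟩
  choose e he0 he using hev
  obtain ⟨ε, hε, hεe⟩ := exists_forall_pos_le ⟨i₀, he0 i₀⟩
  have hev : ∀ᶠ n in atTop, ∀ k, 0 < d k → ε ≤ p n k :=
    eventually_all.2 fun k => by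
      by_cases hk : 0 < d k
      · filter_upwards [he k hk] with n hn _ using (hεe k (he0 k)).trans hn
      · exact Eventually.of_forall fun n h1 => absurd h1 hk
  obtain ⟨C, hC, hCn⟩ := hlim ε hε
  set D := ∑ i, d i
  have hdD : ∀ k, d k ≤ D := fun k => Finset.single_le_sum (fun i _ => hd0 i) (Finset.mem_univ k)
  have hD : 0 < D := hi₀.trans_le (hdD i₀)
  set S := ∑ i, d i ^ γ⁻¹
  have hS : 0 < S := Finset.sum_pos' (fun i _ => Real.rpow_nonneg (hd0 i) _)
    ⟨i₀, Finset.mem_univ _, Real.rpow_pos_of_pos hi₀ _⟩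
  set M := D * ε ^ (-γ)
  have hM : 0 < M := by positivity
  set L := δ ^ (γ⁻¹ - 1) + M ^ (γ⁻¹ - 1)
  have hL : 0 < L := by positivity
  refine ⟨γ⁻¹ * (2 * (D * C) / c) * (L + L) / S, ?_⟩
  filter_upwards [hev, eventually_ge_atTop 2] with n hpε hn j
  have hn0 : 0 < √(n : ℝ) := Real.sqrt_pos.2 (by exact_mod_cast (by omega : 0 < n))
  have hsol := hp n hn
  have hp0 : ∀ k, ¬ 0 < d k → p n k = 0 := fun k hk =>
    le_antisymm (not_lt.1 fun h1 => hk (hsol.pos_of_pos (hh n hn) hd0 hne h1)) (hsol.1.1 k)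
  by_cases hj : 0 < d j
  swap
  · rw [hp0 j hj, le_antisymm (not_lt.1 hj) (hd0 j), Real.zero_rpow (inv_ne_zero hγ.ne')]
    simp only [zero_div, sub_zero, abs_zero]
    positivity
  have hppos : ∀ k, 0 < d k → 0 < p n k := fun k hk => hε.trans_le (hpε k hk)
  set y : Fin K → ℝ := fun k => d k * p n k ^ (-γ)
  have hyδ : ∀ k, 0 < d k → δ ≤ y k := fun k hk => by
    have h1 : 1 ≤ p n k ^ (-γ) := Real.one_le_rpow_of_pos_of_le_one_of_nonpos (hppos k hk)
      (le_one_of_mem_stdSimplex hsol.1 k) (by linarith)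
    exact (hδd k hk).trans (le_mul_of_one_le_right (hd0 k) h1)
  have hyM : ∀ k, 0 < d k → y k ≤ M := fun k hk =>
    mul_le_mul (hdD k) (Real.rpow_le_rpow_of_nonpos hε (hpε k hk) (by linarith))
      (Real.rpow_nonneg (hppos k hk).le _) hD.le
  have hyL : ∀ k, 0 < d k → y k ^ (γ⁻¹ - 1) ≤ L := fun k hk =>
    rpow_le_rpow_add_rpow hδ (hyδ k hk) (hyM k hk) _
  have happrox : ∀ k, 0 < d k →
      |(n : ℝ) ^ γ * (d k * h n (p n k)) - c * y k| ≤ D * C / √n := fun k hk => by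
    have e1 : (n : ℝ) ^ γ * (d k * h n (p n k)) - c * y k =
        d k * ((n : ℝ) ^ γ * h n (p n k) - c * p n k ^ (-γ)) := by
      simp only [y]
      ring
    rw [e1, abs_mul, abs_of_pos hk, mul_div_assoc]
    exact mul_le_mul (hdD k) (hCn n (by omega) _ (hpε k hk) (le_one_of_mem_stdSimplex hsol.1 k))
      (abs_nonneg _) hD.le
  have hydiff : ∀ k, 0 < d k → |y j - y k| ≤ 2 * (D * C) / c / √n := fun k hk => by
    have e1 : d j * h n (p n j) = d k * h n (p n k) :=
      le_antisymm (hsol.le_of_pos (hppos k hk) j) (hsol.le_of_pos (hppos j hj) k)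
    have h1 := abs_le.1 (happrox j hj)
    have h2 := abs_le.1 (happrox k hk)
    rw [e1] at h1
    have h3 : c * |y j - y k| ≤ 2 * (D * C / √n) := by
      nth_rewrite 1 [← abs_of_pos hc]
      rw [← abs_mul, mul_sub]
      exact abs_le.2 ⟨by linarith, by linarith⟩
    rw [div_right_comm, le_div_iff₀ hc, mul_comm, mul_div_assoc]
    exact h3
  have hyroot : ∀ k, 0 < d k → p n k * y k ^ γ⁻¹ = d k ^ γ⁻¹ := fun k hk => by
    rw [Real.mul_rpow hk.le (Real.rpow_nonneg (hppos k hk).le _),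
      ← Real.rpow_mul (hppos k hk).le, neg_mul, mul_inv_cancel₀ hγ.ne', Real.rpow_neg_one]
    field_simp [(hppos k hk).ne']
  set G := γ⁻¹ * (2 * (D * C) / c) * (L + L) / √n
  have hG : 0 ≤ G := by positivity
  have hudiff : ∀ k, 0 < d k → |y j ^ γ⁻¹ - y k ^ γ⁻¹| ≤ G := fun k hk => by
    refine (abs_rpow_sub_rpow_le (hδ.trans_le (hyδ j hj)) (hδ.trans_le (hyδ k hk)) _).trans ?_
    rw [abs_of_pos (inv_pos.2 hγ)]
    calc _ ≤ γ⁻¹ * (2 * (D * C) / c / √n) * (L + L) := by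
          gcongr
          · have := Real.rpow_nonneg (hδ.trans_le (hyδ j hj)).le (γ⁻¹ - 1)
            have := Real.rpow_nonneg (hδ.trans_le (hyδ k hk)).le (γ⁻¹ - 1)
            linarith
          · exact hydiff k hk
          · exact hyL j hj
          · exact hyL k hk
      _ = G := by
          simp only [G]
          ring
  have hterm : ∀ k, |p n k * y j ^ γ⁻¹ - d k ^ γ⁻¹| ≤ p n k * G := fun k => by
    by_cases hk : 0 < d k
    · rw [← hyroot k hk, ← mul_sub, abs_mul, abs_of_pos (hppos k hk)]
      exact mul_le_mul_of_nonneg_left (hudiff k hk) (hppos k hk).le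
    · simp [hp0 k hk, le_antisymm (not_lt.1 hk) (hd0 k), Real.zero_rpow (inv_ne_zero hγ.ne')]
  have hsum : |y j ^ γ⁻¹ - S| ≤ G := by
    have e1 : y j ^ γ⁻¹ - S = ∑ k, (p n k * y j ^ γ⁻¹ - d k ^ γ⁻¹) := by
      rw [Finset.sum_sub_distrib, ← Finset.sum_mul, hsol.1.2, one_mul]
    rw [e1]
    refine (Finset.abs_sum_le_sum_abs _ _).trans ((Finset.sum_le_sum fun k _ => hterm k).trans ?_)
    rw [← Finset.sum_mul, hsol.1.2, one_mul]
  have e2 : p n j - d j ^ γ⁻¹ / S = p n j * (S - y j ^ γ⁻¹) / S := by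
    rw [← hyroot j hj]
    field_simp
  rw [e2, abs_div, abs_mul, abs_of_pos hS, abs_sub_comm, abs_of_pos (hppos j hj), div_right_comm]
  refine div_le_div_of_nonneg_right ?_ hS.le
  calc p n j * |y j ^ γ⁻¹ - S| ≤ 1 * G :=
        mul_le_mul (le_one_of_mem_stdSimplex hsol.1 j) hsum (abs_nonneg _) zero_le_one
    _ = _ := one_mul _

lemma sub_le_div_of_pow_le {x y C : ℝ} {m : ℕ} (hm : m ≠ 0) (hy0 : 0 ≤ y) (hy1 : y ≤ 1)
    (hC : 0 ≤ C) (hxy : x ^ m ≤ C * y ^ m) : x - y ≤ C / m := by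
  have hm0 : (0 : ℝ) < m := by exact_mod_cast Nat.pos_of_ne_zero hm
  by_contra! hlt
  have hδ : 0 < x - y := lt_of_le_of_lt (by positivity) hlt
  rcases hy0.eq_or_lt with rfl | hy
  · rw [zero_pow hm, mul_zero] at hxy
    exact hxy.not_gt (pow_pos (by linarith) m)
  have h1 : 1 + m * (x - y) ≤ (x / y) ^ m := by
    have h2 := one_add_mul_le_pow (a := x / y - 1) (by
      have : 0 < x / y := div_pos (by linarith) hy
      linarith) m
    have h3 : x - y ≤ x / y - 1 := by
      rw [div_sub_one hy.ne', le_div_iff₀ hy]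
      nlinarith
    have h4 := mul_le_mul_of_nonneg_left h3 hm0.le
    have h5 : 1 + (x / y - 1) = x / y := by ring
    rw [h5] at h2
    linarith
  have h2 : (x / y) ^ m ≤ C := by
    rw [div_pow, div_le_iff₀ (pow_pos hy m)]
    exact hxy
  rw [div_lt_iff₀ hm0] at hlt
  linarith

/-- When only the first copy of a type has a value, the solutions are nearly uniform. -/
lemma exists_eventually_abs_sub_inv_le (hdpos : ∀ k, 0 < d k) {p : ℕ → Fin K → ℝ}
    (hp : ∀ n, 2 ≤ n →
      IsVarSolution (stdSimplex ℝ (Fin K)) d (fun x => (1 - x) ^ (n - 1)) (p n)) :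
    ∃ C, ∀ᶠ n : ℕ in atTop, ∀ k, |p n k - 1 / (K : ℝ)| ≤ C / √n := by
  have hne : ∃ D, 0 ≤ D ∧ ∀ j k, d j ≤ D * d k := by
    refine ⟨∑ i, ∑ l, d i / d l, Finset.sum_nonneg fun i _ => Finset.sum_nonneg fun l _ =>
      (div_pos (hdpos i) (hdpos l)).le, fun j k => ?_⟩
    rw [← div_le_iff₀ (hdpos k)]
    exact (Finset.single_le_sum (f := fun l => d j / d l)
      (fun l _ => (div_pos (hdpos j) (hdpos l)).le) (Finset.mem_univ k)).trans
      (Finset.single_le_sum (f := fun i => ∑ l, d i / d l) (fun i _ => Finset.sum_nonneg fun l _ =>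
        (div_pos (hdpos i) (hdpos l)).le) (Finset.mem_univ j))
  obtain ⟨D, hD, hdD⟩ := hne
  refine ⟨2 * D, ?_⟩
  filter_upwards [eventually_ge_atTop 2] with n hn i
  have hsol := hp n hn
  have hmem : ∀ i, p n i ∈ Set.Icc (0 : ℝ) 1 := mem_Icc_of_mem_stdSimplex hsol.1
  have hn1 : n - 1 ≠ 0 := by omega
  have hdiff : ∀ j k, p n j - p n k ≤ D / (n - 1 : ℕ) := fun j k => by
    rcases (hmem j).1.eq_or_lt with hj | hj
    · have : (0 : ℝ) ≤ D / (n - 1 : ℕ) := by positivity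
      linarith [(hmem k).1]
    have h1 := hsol.le_of_pos hj k
    have h2 := sub_le_div_of_pow_le (x := 1 - p n k) (y := 1 - p n j) hn1
      (sub_nonneg.2 (hmem j).2) (by linarith) hD (by
        have h3 : 0 ≤ (1 - p n j) ^ (n - 1) := pow_nonneg (sub_nonneg.2 (hmem j).2) _
        have h4 := mul_le_mul_of_nonneg_right (hdD j k) h3
        have h5 : d k * (1 - p n k) ^ (n - 1) ≤ d k * (D * (1 - p n j) ^ (n - 1)) := by linarith
        exact le_of_mul_le_mul_left h5 (hdpos k))
    linarith
  have hK : (0 : ℝ) < K := by exact_mod_cast i.pos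
  have e : p n i - 1 / (K : ℝ) = (∑ k, (p n i - p n k)) / K := by
    rw [Finset.sum_sub_distrib, hsol.1.2]
    simp [sub_div, hK.ne']
  have hsq : D / (n - 1 : ℕ) ≤ 2 * D / √n := by
    have h1 : √(n : ℝ) ≤ n := by
      rw [Real.sqrt_le_left (by positivity)]
      have : (1 : ℝ) ≤ n := by exact_mod_cast (by omega : 1 ≤ n)
      nlinarith
    have h2 : (n : ℝ) ≤ 2 * (n - 1 : ℕ) := by exact_mod_cast (by omega : n ≤ 2 * (n - 1))
    have h3 : (0 : ℝ) < (n - 1 : ℕ) := by exact_mod_cast Nat.pos_of_ne_zero hn1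
    have h4 : 0 < √(n : ℝ) := Real.sqrt_pos.2 (by exact_mod_cast (by omega : 0 < n))
    rw [div_le_div_iff₀ h3 h4]
    nlinarith
  rw [e, abs_div, abs_of_pos hK, div_le_iff₀ hK]
  refine (Finset.abs_sum_le_sum_abs _ _).trans ((Finset.sum_le_card_nsmul _ _ _ fun k _ =>
    (abs_sub_le_iff.2 ⟨hdiff i k, hdiff k i⟩).trans hsq).trans_eq ?_)
  simp [mul_comm]

lemma convergesAtRate_of_le {p : ℕ → Fin K → ℝ} {q : Fin K → ℝ}
    (h : ∃ C, ∀ᶠ n : ℕ in atTop, ∀ k, |p n k - q k| ≤ C / √n) : ConvergesAtRate p q := by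
  obtain ⟨C, hC⟩ := h
  refine ⟨tendsto_pi_nhds.2 fun k => ?_, fun k => ?_⟩
  · rw [tendsto_iff_norm_sub_tendsto_zero]
    refine squeeze_zero' (Eventually.of_forall fun n => norm_nonneg _) (hC.mono fun n hn => hn k)
      ((Real.tendsto_sqrt_atTop.comp tendsto_natCast_atTop_atTop).const_div_atTop C)
  · refine IsBigO.of_bound |C| ?_
    filter_upwards [hC, eventually_ge_atTop 3] with n hn hn3
    have hlog : 1 ≤ Real.log n := by
      rw [Real.le_log_iff_exp_le (by exact_mod_cast (by omega : 0 < n))]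
      have : (3 : ℝ) ≤ n := by exact_mod_cast hn3
      linarith [Real.exp_one_lt_d9]
    rw [Real.norm_eq_abs, Real.norm_eq_abs, abs_of_nonneg (Real.sqrt_nonneg _),
      Real.sqrt_div (by linarith)]
    refine (hn k).trans ?_
    rw [← mul_div_assoc]
    gcongr
    calc C ≤ |C| * 1 := by simpa using le_abs_self C
      _ ≤ |C| * √(Real.log n) := by
        gcongr
        exact Real.one_le_sqrt.2 hlog

end

section

variable {K : ℕ} {d : Fin K → ℝ}

lemma recip_powerScore_top (x : ℕ) :
    recip (powerScore ⊤) (1 + x) = if x = 0 then 1 else 0 := by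
  by_cases hx : x = 0
  · simp [recip, powerScore, hx]
  · have : ¬ 1 + x ≤ 1 := by omega
    simp [recip, powerScore, hx]

lemma recip_powerScore {γ : ℝ≥0∞} (hγ : γ ≠ ⊤) {x : ℕ} (hx : 1 ≤ x) :
    recip (powerScore γ) x = (x : ℝ) ^ (-γ.toReal) := by
  rcases hx.eq_or_lt with rfl | hx1
  · simp [recip, powerScore]
  · have : ¬ x ≤ 1 := by omega
    simp only [recip, powerScore, this, hγ, if_false, ENNReal.toReal_inv, ← ENNReal.toReal_rpow,
      ENNReal.toReal_natCast]
    rw [Real.rpow_neg x.cast_nonneg]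

lemma ratio_powerScore {γ : ℝ≥0∞} (hγ : γ ≠ ⊤) (hγ1 : γ.toReal ≠ 1) (x : ℕ) :
    ratio (powerScore γ) x = (x : ℝ) ^ (1 - γ.toReal) := by
  rcases Nat.eq_zero_or_pos x with rfl | hx
  · simp [ratio, Real.zero_rpow (sub_ne_zero.2 hγ1.symm)]
  · rw [ratio, recip_powerScore hγ hx, sub_eq_add_neg, Real.rpow_add (by exact_mod_cast hx),
      Real.rpow_one]

lemma two_mul_rpow_neg_le {g x : ℝ} (hg : 0 ≤ g) (hx : 0 < x) :
    2 * (x + 1) ^ (-g) ≤ x ^ (-g) + (x + 2) ^ (-g) := by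
  have hsq : ∀ y : ℝ, 0 < y → (y ^ (-g / 2)) ^ 2 = y ^ (-g) := fun y hy => by
    rw [← Real.rpow_natCast, ← Real.rpow_mul hy.le]
    norm_num
  have h1 : (x + 1) ^ (-g) ≤ x ^ (-g / 2) * (x + 2) ^ (-g / 2) := by
    rw [← Real.mul_rpow hx.le (by linarith), ← hsq _ (by linarith),
      Real.rpow_pow_comm (by linarith)]
    exact Real.rpow_le_rpow_of_nonpos (by positivity) (by nlinarith) (by linarith)
  have h2 := two_mul_le_add_sq (x ^ (-g / 2)) ((x + 2) ^ (-g / 2))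
  rw [hsq _ hx, hsq _ (by linarith)] at h2
  linarith

lemma isDownScore_powerScore {γ : ℝ≥0∞} (hγ : 1 ≤ γ) : IsDownScore (powerScore γ) := by
  have hone : ∀ y, 1 ≤ powerScore γ y := fun y => by
    unfold powerScore
    split_ifs with h1 h2
    · rfl
    · exact le_top
    · refine ENNReal.one_le_rpow (by exact_mod_cast (by omega : 1 ≤ y)) ?_
      exact ENNReal.toReal_pos (zero_lt_one.trans_le hγ).ne' h2
  refine ⟨fun x y hx hxy => ?_, fun x hx => ?_, by simp [powerScore], ⟨2, by norm_num, ?_⟩,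
    fun x y hx hxy => ?_⟩
  · by_cases hx1 : x ≤ 1
    · rw [powerScore, if_pos hx1]
      exact hone y
    · have hy1 : ¬ y ≤ 1 := by omega
      simp only [powerScore, hx1, hy1, if_false]
      split_ifs
      · rfl
      · exact ENNReal.rpow_le_rpow (by exact_mod_cast hxy) ENNReal.toReal_nonneg
  · by_cases htop : γ = ⊤
    · subst htop
      obtain ⟨x, rfl⟩ := Nat.exists_eq_add_of_le hx
      simp only [add_assoc, recip_powerScore_top]
      split_ifs <;> simp_all
    · rw [recip_powerScore htop hx, recip_powerScore htop (by omega),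
        recip_powerScore htop (by omega)]
      have := two_mul_rpow_neg_le (g := γ.toReal) ENNReal.toReal_nonneg
        (by exact_mod_cast hx : (0 : ℝ) < x)
      push_cast
      linarith
  · unfold powerScore
    split_ifs with h1 h2
    · omega
    · exact ENNReal.one_lt_top
    · exact ENNReal.one_lt_rpow (by norm_num)
        (ENNReal.toReal_pos (zero_lt_one.trans_le hγ).ne' h2)
  · by_cases htop : γ = ⊤
    · subst htop
      obtain ⟨x, rfl⟩ := Nat.exists_eq_add_of_le hx
      obtain ⟨y, rfl⟩ := Nat.exists_eq_add_of_le (hx.trans hxy)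
      simp only [ratio, recip_powerScore_top]
      split_ifs with h1 h2 h2
      · simp [h1, h2]
      · omega
      · simpa using by positivity
      · simp
    · have hg : 1 ≤ γ.toReal := by
        rw [← ENNReal.toReal_one]
        exact ENNReal.toReal_mono htop hγ
      have e : ∀ z : ℕ, 1 ≤ z → ratio (powerScore γ) z = (z : ℝ) ^ (1 - γ.toReal) := fun z hz => by
        rw [ratio, recip_powerScore htop hz, sub_eq_add_neg,
          Real.rpow_add (by exact_mod_cast hz), Real.rpow_one]
      rw [e x hx, e y (hx.trans hxy)]
      exact Real.rpow_le_rpow_of_nonpos (by exact_mod_cast hx) (by exact_mod_cast hxy)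
        (by linarith)

lemma not_isDownScore_powerScore {γ : ℝ≥0∞} (hγ : γ < 1) : ¬ IsDownScore (powerScore γ) := by
  intro h
  have htop : γ ≠ ⊤ := (hγ.trans ENNReal.one_lt_top).ne
  have hg : γ.toReal < 1 := by
    rw [← ENNReal.toReal_one]
    exact ENNReal.toReal_strict_mono ENNReal.one_ne_top hγ
  have h1 := h.ratio_anti 1 2 le_rfl (by norm_num)
  rw [ratio_powerScore htop hg.ne, ratio_powerScore htop hg.ne, Nat.cast_one, Real.one_rpow] at h1
  exact h1.not_gt (Real.one_lt_rpow (by norm_num) (by linarith))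

section Increments

variable {g : ℝ}

lemma exists_add_one_rpow_sub_rpow_eq (hg1 : g < 1) {x : ℝ} (hx : 0 ≤ x) :
    ∃ ξ, x < ξ ∧ ξ < x + 1 ∧ (x + 1) ^ (1 - g) - x ^ (1 - g) = (1 - g) * ξ ^ (-g) := by
  obtain ⟨ξ, hξ, hs⟩ := exists_hasDerivAt_eq_slope (fun t : ℝ => t ^ (1 - g))
    (fun t => (1 - g) * t ^ ((1 - g) - 1)) (lt_add_one x)
    (fun t ht => (Real.continuousAt_rpow_const _ _ (Or.inr (by linarith))).continuousWithinAt)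
    (fun t ht => Real.hasDerivAt_rpow_const (Or.inl (hx.trans_lt ht.1).ne'))
  refine ⟨ξ, hξ.1, hξ.2, ?_⟩
  rw [add_sub_cancel_left, div_one] at hs
  rw [← hs, show (1 - g) - 1 = -g by ring]

lemma le_add_one_rpow_sub_rpow (hg0 : 0 < g) (hg1 : g < 1) {x : ℝ} (hx : 0 ≤ x) :
    (1 - g) * (x + 1) ^ (-g) ≤ (x + 1) ^ (1 - g) - x ^ (1 - g) := by
  obtain ⟨ξ, h1, h2, h3⟩ := exists_add_one_rpow_sub_rpow_eq hg1 hx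
  rw [h3]
  exact mul_le_mul_of_nonneg_left (Real.rpow_le_rpow_of_nonpos (hx.trans_lt h1) h2.le
    (by linarith)) (by linarith)

lemma add_one_rpow_sub_rpow_lt (hg0 : 0 < g) (hg1 : g < 1) {x : ℝ} (hx : 0 < x) :
    (x + 1) ^ (1 - g) - x ^ (1 - g) < (1 - g) * x ^ (-g) := by
  obtain ⟨ξ, h1, h2, h3⟩ := exists_add_one_rpow_sub_rpow_eq hg1 hx.le
  rw [h3]
  exact mul_lt_mul_of_pos_left (Real.rpow_lt_rpow_of_neg hx h1 (by linarith)) (by linarith)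

lemma strictAnti_add_one_rpow_sub_rpow (hg0 : 0 < g) (hg1 : g < 1) :
    StrictAnti fun x : ℕ => ((x + 1 : ℕ) : ℝ) ^ (1 - g) - (x : ℝ) ^ (1 - g) := by
  refine strictAnti_nat_of_succ_lt fun x => ?_
  have h1 := le_add_one_rpow_sub_rpow hg0 hg1 (x := x) x.cast_nonneg
  have h2 := add_one_rpow_sub_rpow_lt hg0 hg1 (x := (x : ℝ) + 1) (by positivity)
  push_cast
  linarith

lemma abs_add_one_rpow_sub_rpow_sub_le (hg0 : 0 < g) (hg1 : g < 1) (x : ℕ) :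
    |((x + 1 : ℕ) : ℝ) ^ (1 - g) - (x : ℝ) ^ (1 - g) - (1 - g) * ((x : ℝ) + 1) ^ (-g)| ≤
      5 * ((x : ℝ) + 1) ^ (-g - 1) := by
  push_cast
  rcases Nat.eq_zero_or_pos x with rfl | hx
  · rw [Nat.cast_zero, zero_add, Real.one_rpow, Real.one_rpow, Real.one_rpow,
      Real.zero_rpow (by linarith), abs_le]
    constructor <;> linarith
  have hx1 : (1 : ℝ) ≤ x := by exact_mod_cast hx
  obtain ⟨ξ, h1, h2, h3⟩ := exists_add_one_rpow_sub_rpow_eq hg1 (x := x) x.cast_nonneg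
  have hξ : 0 < ξ := by linarith
  have h4 := abs_rpow_sub_rpow_le hξ (by positivity : (0 : ℝ) < x + 1) (-g)
  rw [abs_neg, abs_of_pos hg0] at h4
  have h5 : ξ ^ (-g - 1) ≤ 4 * ((x : ℝ) + 1) ^ (-g - 1) := by
    have h6 : ξ ^ (-g - 1) ≤ (((x : ℝ) + 1) / 2) ^ (-g - 1) :=
      Real.rpow_le_rpow_of_nonpos (by positivity) (by linarith) (by linarith)
    have h7 : (2 : ℝ) ^ (g + 1) ≤ 4 := by
      calc (2 : ℝ) ^ (g + 1) ≤ 2 ^ (2 : ℝ) :=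
            Real.rpow_le_rpow_of_exponent_le (by norm_num) (by linarith)
        _ = 4 := by norm_num
    rw [Real.div_rpow (by positivity) (by norm_num), ← neg_add', Real.rpow_neg zero_le_two,
      div_inv_eq_mul, neg_add'] at h6
    have h8 : (0 : ℝ) ≤ ((x : ℝ) + 1) ^ (-g - 1) := by positivity
    nlinarith
  have h9 : |ξ - ((x : ℝ) + 1)| ≤ 1 := abs_le.2 ⟨by linarith, by linarith⟩
  rw [h3, ← mul_sub, abs_mul, abs_of_pos (by linarith : 0 < 1 - g)]
  have h10 : (0 : ℝ) ≤ ξ ^ (-g - 1) + ((x : ℝ) + 1) ^ (-g - 1) := by positivity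
  calc (1 - g) * |ξ ^ (-g) - ((x : ℝ) + 1) ^ (-g)|
      ≤ 1 * (1 * 1 * (4 * ((x : ℝ) + 1) ^ (-g - 1) + ((x : ℝ) + 1) ^ (-g - 1))) := by
        refine mul_le_mul (by linarith) (h4.trans ?_) (abs_nonneg _) zero_le_one
        gcongr
    _ = _ := by ring

end Increments

lemma IsSymmOptimum.isVarSolution {n : ℕ} (hn : 1 ≤ n) {s : ℕ → ℝ≥0∞} {v : ℕ → ℝ}
    (hw : ∀ p, welfare n d s p = ∑ k, d k * binomExpect n (p k) v) {p : Fin K → ℝ}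
    (hp : IsSymmOptimum n d s p) : IsVarSolution (strategies K) d
      (fun x => binomExpect (n - 1) x fun j => v (j + 1) - v j) p := by
  obtain ⟨n, rfl⟩ := Nat.exists_eq_add_of_le' hn
  refine isVarSolution_of_max (f := fun x => binomExpect (n + 1) x v / (n + 1))
    convex_strategies (fun x => ?_) hp.1 fun p' hp' => ?_
  · refine ((hasDerivAt_binomExpect n v x).div_const _).congr_deriv ?_
    rw [Nat.add_sub_cancel]
    field_simp
  · have h := hp.2 p' hp'
    rw [hw, hw] at h
    simp only [← mul_div_assoc, ← Finset.sum_div]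
    gcongr

lemma existsUnique_isSymmOptimum (hd0 : ∀ k, 0 ≤ d k) (hd : Antitone d) (hne : d ≠ 0)
    {n : ℕ} (hn : 2 ≤ n) {s : ℕ → ℝ≥0∞} {v : ℕ → ℝ}
    (hw : ∀ p, welfare n d s p = ∑ k, d k * binomExpect n (p k) v)
    (hv : IsMarginal fun x => binomExpect (n - 1) x fun j => v (j + 1) - v j) :
    ∃! p, IsSymmOptimum n d s p := by
  obtain ⟨q, hq, hu⟩ := existsUnique_isVarSolution hv hd0 hd hne
    (hasDerivAt_antideriv_binomExpect _ _)
  obtain ⟨p, hp, hmax⟩ := exists_max (d := d) isCompact_strategies ⟨q, hq.1⟩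
    (continuous_binomExpect n v)
  have hopt : IsSymmOptimum n d s p := ⟨hp, fun p' hp' => by simpa only [hw] using hmax p' hp'⟩
  exact ⟨p, hopt, fun p' hp' => (hu p' (hp'.isVarSolution (by omega) hw)).trans
    (hu p (hopt.isVarSolution (by omega) hw)).symm⟩

lemma pDagger_eq {γ : ℝ≥0∞} (k : Fin K) :
    pDagger d γ k = d k ^ γ.toReal⁻¹ / ∑ i, d i ^ γ.toReal⁻¹ := by
  simp only [pDagger, ENNReal.toReal_inv]

lemma convergesAtRate_pDagger {g c A : ℝ} {γ : ℝ≥0∞} (hγ : γ.toReal = g) (hg : 0 < g) (hc : 0 < c)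
    (hA : 0 ≤ A) {a : ℕ → ℝ}
    (ha : ∀ x : ℕ, |a x - c * ((x : ℝ) + 1) ^ (-g)| ≤ A * ((x : ℝ) + 1) ^ (-g - 1))
    (hm : ∀ n, 2 ≤ n → IsMarginal fun x => binomExpect (n - 1) x a)
    (hd0 : ∀ k, 0 ≤ d k) (hd : Antitone d) (hne : d ≠ 0) {p : ℕ → Fin K → ℝ}
    (hp : ∀ n, 2 ≤ n →
      IsVarSolution (strategies K) d (fun x => binomExpect (n - 1) x a) (p n)) :
    ConvergesAtRate p (pDagger d γ) := by
  refine convergesAtRate_of_le ?_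
  simp only [pDagger_eq, hγ]
  exact exists_eventually_abs_sub_le hg hc (h := fun n x => binomExpect (n - 1) x a) hm
    (fun ε hε => exists_abs_binomExpect_sub_le hg hA hε ha) hd0 hne
    fun n hn => (hp n hn).stdSimplex (hm n hn) hd0 hd hne (hasDerivAt_antideriv_binomExpect _ _)

lemma isMarginal_indicator {n : ℕ} (hn : 2 ≤ n) :
    IsMarginal fun x => binomExpect (n - 1) x fun j => if j = 0 then 1 else 0 := by
  refine isMarginal_binomExpect (by omega) (antitone_nat_of_succ_le fun x => ?_) (fun x => ?_)
    (by simp)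
  · simp only [Nat.add_eq_zero_iff, one_ne_zero, and_false, if_false]
    split_ifs <;> simp
  · split_ifs <;> simp

lemma convergesAtRate_uniform (hdpos : ∀ k, 0 < d k) (hd : Antitone d) (hne : d ≠ 0)
    {p : ℕ → Fin K → ℝ}
    (hp : ∀ n, 2 ≤ n → IsVarSolution (strategies K) d
      (fun x => binomExpect (n - 1) x fun j => if j = 0 then 1 else 0) (p n)) :
    ConvergesAtRate p fun _ => 1 / (K : ℝ) := by
  refine convergesAtRate_of_le (exists_eventually_abs_sub_inv_le hdpos fun n hn => ?_)
  have h := (hp n hn).stdSimplex (isMarginal_indicator hn) (fun k => (hdpos k).le) hd hne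
    (hasDerivAt_antideriv_binomExpect _ _)
  simpa only [binomExpect_indicator_zero] using h

lemma isMarginal_recip_powerScore {γ : ℝ≥0∞} (hγ : 0 < γ) {n : ℕ} (hn : 2 ≤ n) :
    IsMarginal fun x => binomExpect (n - 1) x fun j => recip (powerScore γ) (1 + j) := by
  by_cases htop : γ = ⊤
  · subst htop
    simpa only [recip_powerScore_top] using isMarginal_indicator hn
  have hg := ENNReal.toReal_pos hγ.ne' htop
  have e : ∀ j, recip (powerScore γ) (1 + j) = ((1 + j : ℕ) : ℝ) ^ (-γ.toReal) :=
    fun j => recip_powerScore htop (by omega)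
  simp only [e]
  refine isMarginal_binomExpect (by omega) (fun x y hxy => ?_) (fun x => by positivity) ?_
  · refine Real.rpow_le_rpow_of_nonpos (by positivity) ?_ (by linarith)
    exact_mod_cast Nat.add_le_add_left hxy 1
  · norm_num
    exact Real.rpow_lt_one_of_one_lt_of_neg (by norm_num) (by linarith)

lemma convergesAtRate_equilibrium (hd0 : ∀ k, 0 ≤ d k) (hd : Antitone d) (hne : d ≠ 0)
    {γ : ℝ≥0∞} (hγ : 0 < γ) (hpos : γ = ⊤ → ∀ k, 0 < d k) {p : ℕ → Fin K → ℝ}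
    (hp : ∀ n, 2 ≤ n → IsSymmEquilibrium n d (powerScore γ) (p n)) :
    ConvergesAtRate p (pDagger d γ) := by
  by_cases htop : γ = ⊤
  · subst htop
    have e : pDagger d ⊤ = fun _ => 1 / (K : ℝ) := by
      ext k
      simp [pDagger]
    rw [e]
    refine convergesAtRate_uniform (hpos rfl) hd hne fun n hn => ?_
    have h : IsVarSolution (strategies K) d (fun x => binomExpect (n - 1) x fun j =>
      recip (powerScore ⊤) (1 + j)) (p n) := hp n hn
    simpa only [recip_powerScore_top] using h
  · refine convergesAtRate_pDagger (c := 1) (A := 0) rfl (ENNReal.toReal_pos hγ.ne' htop) one_pos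
      le_rfl (fun x => ?_) (fun n hn => isMarginal_recip_powerScore hγ hn) hd0 hd hne hp
    rw [recip_powerScore htop (by omega)]
    push_cast
    simp [add_comm]

lemma welfare_of_isDownScore {s : ℕ → ℝ≥0∞} (hs : IsDownScore s) (n : ℕ) (p : Fin K → ℝ) :
    welfare n d s p = ∑ k, d k * binomExpect n (p k) (fun x => if 0 < x then 1 else 0) :=
  if_pos hs

lemma welfare_of_not_isDownScore {s : ℕ → ℝ≥0∞} (hs : ¬ IsDownScore s) (n : ℕ)
    (p : Fin K → ℝ) : welfare n d s p = ∑ k, d k * binomExpect n (p k) (ratio s) :=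
  if_neg hs

lemma increment_indicator_pos :
    (fun j : ℕ => (if 0 < j + 1 then (1 : ℝ) else 0) - if 0 < j then 1 else 0) =
      fun j => if j = 0 then 1 else 0 := by
  ext j
  rcases Nat.eq_zero_or_pos j with rfl | hj
  · simp
  · simp [hj, hj.ne']

lemma optimum_of_isDownScore (hd0 : ∀ k, 0 ≤ d k) (hd : Antitone d) (hne : d ≠ 0)
    {s : ℕ → ℝ≥0∞} (hs : IsDownScore s) :
    (∀ n, 2 ≤ n → ∃! p, IsSymmOptimum n d s p) ∧
      ((∀ k, 0 < d k) → ∀ p : ℕ → Fin K → ℝ, (∀ n, 2 ≤ n → IsSymmOptimum n d s (p n)) →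
        ConvergesAtRate p (fun _ => 1 / (K : ℝ))) := by
  refine ⟨fun n hn => existsUnique_isSymmOptimum hd0 hd hne hn (welfare_of_isDownScore hs n) ?_,
    fun hpos p hp => convergesAtRate_uniform hpos hd hne fun n hn => ?_⟩
  · rw [increment_indicator_pos]
    exact isMarginal_indicator hn
  · have h := (hp n hn).isVarSolution (by omega) (welfare_of_isDownScore hs n)
    rwa [increment_indicator_pos] at h

lemma optimum_powerScore_of_lt_one (hd0 : ∀ k, 0 ≤ d k) (hd : Antitone d) (hne : d ≠ 0)
    {γ : ℝ≥0∞} (hγ0 : 0 < γ) (hγ1 : γ < 1) :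
    (∀ n, 2 ≤ n → ∃! p, IsSymmOptimum n d (powerScore γ) p) ∧
      ∀ p : ℕ → Fin K → ℝ, (∀ n, 2 ≤ n → IsSymmOptimum n d (powerScore γ) (p n)) →
        ConvergesAtRate p (pDagger d γ) := by
  have htop : γ ≠ ⊤ := (hγ1.trans ENNReal.one_lt_top).ne
  have hg0 : 0 < γ.toReal := ENNReal.toReal_pos hγ0.ne' htop
  have hg1 : γ.toReal < 1 := by
    rw [← ENNReal.toReal_one]
    exact ENNReal.toReal_strict_mono ENNReal.one_ne_top hγ1
  have hw : ∀ n (p : Fin K → ℝ), welfare n d (powerScore γ) p =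
      ∑ k, d k * binomExpect n (p k) (fun x => (x : ℝ) ^ (1 - γ.toReal)) := fun n p => by
    rw [welfare_of_not_isDownScore (not_isDownScore_powerScore hγ1)]
    simp only [funext (ratio_powerScore htop hg1.ne)]
  have hm : ∀ n, 2 ≤ n → IsMarginal fun x => binomExpect (n - 1) x fun j : ℕ =>
      ((j + 1 : ℕ) : ℝ) ^ (1 - γ.toReal) - (j : ℝ) ^ (1 - γ.toReal) := fun n hn =>
    isMarginal_binomExpect (by omega) (strictAnti_add_one_rpow_sub_rpow hg0 hg1).antitone
      (fun x => by
        have h1 := le_add_one_rpow_sub_rpow hg0 hg1 (x := x) x.cast_nonneg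
        have h2 : 0 ≤ (1 - γ.toReal) * ((x : ℝ) + 1) ^ (-γ.toReal) :=
          mul_nonneg (by linarith) (by positivity)
        push_cast
        linarith)
      (strictAnti_add_one_rpow_sub_rpow hg0 hg1 zero_lt_one)
  exact ⟨fun n hn => existsUnique_isSymmOptimum hd0 hd hne hn (hw n) (hm n hn), fun p hp =>
    convergesAtRate_pDagger rfl hg0 (sub_pos.2 hg1) (by norm_num)
      (abs_add_one_rpow_sub_rpow_sub_le hg0 hg1) hm hd0 hd hne
      fun n hn => (hp n hn).isVarSolution (by omega) (hw n)⟩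

end

end ContentGame

/-- Symmetric equilibria and symmetric optima as the number of players grows. In each part, the
equilibrium (optimum) is shown to be unique for each `n ≥ 2`, so that the sequence `p` is the
sequence of the equilibria (optima). -/
theorem mainTheorem6 (K : ℕ) (d : Fin K → ℝ) (hd_nonneg : ∀ k, 0 ≤ d k)
    (hd_anti : Antitone d) (hd_ne : d ≠ 0) :
    (∀ γ : ℝ≥0∞, 0 < γ →
      (∀ n, 2 ≤ n → ∃! p, ContentGame.IsSymmEquilibrium n d (ContentGame.powerScore γ) p) ∧
      ((γ = ⊤ → ∀ k, 0 < d k) → ∀ p : ℕ → Fin K → ℝ,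
        (∀ n, 2 ≤ n → ContentGame.IsSymmEquilibrium n d (ContentGame.powerScore γ) (p n)) →
        ContentGame.ConvergesAtRate p (ContentGame.pDagger d γ))) ∧
    (∀ γ : ℝ≥0∞, 0 < γ → γ < 1 →
      (∀ n, 2 ≤ n → ∃! p, ContentGame.IsSymmOptimum n d (ContentGame.powerScore γ) p) ∧
      ∀ p : ℕ → Fin K → ℝ,
        (∀ n, 2 ≤ n → ContentGame.IsSymmOptimum n d (ContentGame.powerScore γ) (p n)) →
        ContentGame.ConvergesAtRate p (ContentGame.pDagger d γ)) ∧
    (∀ s : ℕ → ℝ≥0∞, ContentGame.IsDownScore s →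
      (∀ n, 2 ≤ n → ∃! p, ContentGame.IsSymmOptimum n d s p) ∧
      ((∀ k, 0 < d k) → ∀ p : ℕ → Fin K → ℝ,
        (∀ n, 2 ≤ n → ContentGame.IsSymmOptimum n d s (p n)) →
        ContentGame.ConvergesAtRate p (fun _ => 1 / (K : ℝ)))) ∧
    (∀ γ : ℝ≥0∞, 1 ≤ γ →
      (∀ n, 2 ≤ n → ∃! p, ContentGame.IsSymmOptimum n d (ContentGame.powerScore γ) p) ∧
      ((∀ k, 0 < d k) → ∀ p : ℕ → Fin K → ℝ,
        (∀ n, 2 ≤ n → ContentGame.IsSymmOptimum n d (ContentGame.powerScore γ) (p n)) →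
        ContentGame.ConvergesAtRate p (fun _ => 1 / (K : ℝ)))) := by
  refine ⟨fun γ hγ => ⟨fun n hn => ?_, fun hpos p hp => ?_⟩, fun γ hγ0 hγ1 => ?_, fun s hs => ?_,
    fun γ hγ => ?_⟩
  · exact ContentGame.existsUnique_isVarSolution (ContentGame.isMarginal_recip_powerScore hγ hn)
      hd_nonneg hd_anti hd_ne (ContentGame.hasDerivAt_antideriv_binomExpect _ _)
  · exact ContentGame.convergesAtRate_equilibrium hd_nonneg hd_anti hd_ne hγ hpos hp
  · exact ContentGame.optimum_powerScore_of_lt_one hd_nonneg hd_anti hd_ne hγ0 hγ1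
  · exact ContentGame.optimum_of_isDownScore hd_nonneg hd_anti hd_ne hs
  · exact ContentGame.optimum_of_isDownScore hd_nonneg hd_anti hd_ne
      (ContentGame.isDownScore_powerScore hγ)
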